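/- Let $G$ be an essential real reflection group of rank $n$, that is, a finite group of orthogonal transformations of $V=\mathbb{R}^n$ that is generated by reflections and does not fix pointwise any nonzero linear subspace of $V$. Let $\pi_1,\dots,\pi_n\in\mathbb{R}[x_1,\dots,x_n]$ be a set of basic invariants of $G$, that is, algebraically independent homogeneous polynomials that generate the algebra $\mathbb{R}[V]^G$ of $G$-invariant polynomials. Let $f_1,\dots,f_m\in\mathbb{R}[x_1,\dots,x_n]$ be such that the real variety $$X=V_{\mathbb{R}}(f_1,\dots,f_m)=\{p\in\mathbb{R}^n : f_1(p)=\dots=f_m(p)=0\}$$ is nonempty. If there is an index $j\in\{1,\dots,n\}$ such that $f_1,\dots,f_m\in\mathbb{R}[\pi_i : i\neq j]$, then $X\cap\mathcal{H}_{n-1}(G)\neq\emptyset$. Here $\mathcal{H}_{i}(G)$ denotes the set of points of $V$ that lie in an $i$-dimensional flat, a flat being an intersection of reflection hyperplanes of $G$ (the fixed hyperplanes of the reflections in $G$); so $\mathcal{H}_{n-1}(G)$ is the union of the reflection hyperplanes of $G$. -/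

import Mathlib

namespace ReflectionGroups

noncomputable section

/-- An orthogonal transformation of `ℝⁿ` is a reflection if it is the orthogonal reflection in
the hyperplane orthogonal to some nonzero vector. -/
def IsReflection {n : ℕ} (g : EuclideanSpace ℝ (Fin n) ≃ₗᵢ[ℝ] EuclideanSpace ℝ (Fin n)) : Prop :=
  ∃ v : EuclideanSpace ℝ (Fin n), v ≠ 0 ∧ g = (ℝ ∙ v)ᗮ.reflection

/-- A reflection group: a finite group of orthogonal transformations generated by reflections. -/
structure IsReflectionGroup {n : ℕ}
    (G : Subgroup (EuclideanSpace ℝ (Fin n) ≃ₗᵢ[ℝ] EuclideanSpace ℝ (Fin n))) : Prop where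
  finite : Finite G
  generated : Subgroup.closure {g | g ∈ G ∧ IsReflection g} = G

/-- `G` is essential if it fixes (pointwise) no nontrivial linear subspace. -/
def IsEssential {n : ℕ}
    (G : Subgroup (EuclideanSpace ℝ (Fin n) ≃ₗᵢ[ℝ] EuclideanSpace ℝ (Fin n))) : Prop :=
  ∀ W : Submodule ℝ (EuclideanSpace ℝ (Fin n)), (∀ g ∈ G, ∀ w ∈ W, g w = w) → W = ⊥

/-- The hyperplane of fixed points of `g`, for each reflection `g ∈ G`. -/
def arrangement {n : ℕ}
    (G : Subgroup (EuclideanSpace ℝ (Fin n) ≃ₗᵢ[ℝ] EuclideanSpace ℝ (Fin n))) :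
    Set (Submodule ℝ (EuclideanSpace ℝ (Fin n))) :=
  {H | ∃ g ∈ G, IsReflection g ∧
    H = LinearMap.ker (g.toLinearEquiv.toLinearMap - LinearMap.id)}

/-- The flats are the intersections of hyperplanes of the arrangement; the empty intersection is
the whole space. -/
def IsFlat {n : ℕ}
    (G : Subgroup (EuclideanSpace ℝ (Fin n) ≃ₗᵢ[ℝ] EuclideanSpace ℝ (Fin n)))
    (F : Submodule ℝ (EuclideanSpace ℝ (Fin n))) : Prop :=
  ∃ S : Set (Submodule ℝ (EuclideanSpace ℝ (Fin n))), S ⊆ arrangement G ∧ F = sInf S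

/-- The stratum `H_i(G)`: the points that are contained in a flat of dimension `i`. -/
def stratum {n : ℕ}
    (G : Subgroup (EuclideanSpace ℝ (Fin n) ≃ₗᵢ[ℝ] EuclideanSpace ℝ (Fin n))) (i : ℕ) :
    Set (EuclideanSpace ℝ (Fin n)) :=
  {p | ∃ F : Submodule ℝ (EuclideanSpace ℝ (Fin n)),
    IsFlat G F ∧ Module.finrank ℝ F = i ∧ p ∈ F}

/-- The value of a real polynomial at a point of `ℝⁿ`. -/
def evalAt {n : ℕ} (p : EuclideanSpace ℝ (Fin n)) (f : MvPolynomial (Fin n) ℝ) : ℝ :=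
  MvPolynomial.eval (fun i => p i) f

/-- The ring `ℝ[V]^G` of polynomials with `f (g⁻¹ x) = f x` for all `g ∈ G`. Over `ℝ`, equality of
polynomials is the same as equality of their values at all points. -/
def invariants {n : ℕ}
    (G : Subgroup (EuclideanSpace ℝ (Fin n) ≃ₗᵢ[ℝ] EuclideanSpace ℝ (Fin n))) :
    Subalgebra ℝ (MvPolynomial (Fin n) ℝ) where
  carrier := {f | ∀ g ∈ G, ∀ x : EuclideanSpace ℝ (Fin n), evalAt (g⁻¹ x) f = evalAt x f}
  mul_mem' := by
    intro a b ha hb g hg x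
    have h1 := ha g hg x
    have h2 := hb g hg x
    simp only [evalAt, map_mul] at *
    rw [h1, h2]
  add_mem' := by
    intro a b ha hb g hg x
    have h1 := ha g hg x
    have h2 := hb g hg x
    simp only [evalAt, map_add] at *
    rw [h1, h2]
  algebraMap_mem' := by
    intro r g _ x
    simp [evalAt, MvPolynomial.algebraMap_eq]

/-- A set of basic invariants of `G`: algebraically independent homogeneous polynomials
`π₁, …, πₙ` that generate `ℝ[V]^G` as an `ℝ`-algebra. -/
structure IsBasicInvariants {n : ℕ}
    (G : Subgroup (EuclideanSpace ℝ (Fin n) ≃ₗᵢ[ℝ] EuclideanSpace ℝ (Fin n)))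
    (π : Fin n → MvPolynomial (Fin n) ℝ) : Prop where
  algebraicIndependent : AlgebraicIndependent ℝ π
  homogeneous : ∀ i, ∃ d : ℕ, (π i).IsHomogeneous d
  generate : Algebra.adjoin ℝ (Set.range π) = invariants G

/-- The real variety `V_ℝ(f₁, …, fₘ)`. -/
def realVariety {n m : ℕ} (f : Fin m → MvPolynomial (Fin n) ℝ) :
    Set (EuclideanSpace ℝ (Fin n)) :=
  {p | ∀ k, evalAt p (f k) = 0}

end

end ReflectionGroups

/-! Suppose X misses every mirror, take p in X, and let L be the line through π(p) in the j-th
coordinate direction. The f_k are polynomials in the other invariants, so every x with π(x) in L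
lies in X. The part of L inside the image of π is nonempty; it is shown to be closed and open in L,
hence all of L, which is impossible.

Openness: G acts freely off its mirrors (`eq_one_of_apply_eq_self`), and at a point with trivial
stabilizer the invariants separate tangent directions (`exists_invariant_fderiv_ne_zero`). So π has
invertible differential there and is open (`map_nhds_polyMap`).

Closedness: an essential group has no nonzero linear invariants, so ‖x‖² is a linear combination of
the π_i (`exists_norm_sq_eq_sum`). This makes π proper. On L it makes ‖x‖² an affine function of the
parameter; being nonnegative on all of L, it would be constant, so π_j would be bounded on the
preimage of L although it is the coordinate along L (`exists_update_notMem_range_polyMap`). -/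

namespace ReflectionGroups

open scoped RealInnerProductSpace

/-! ### Simple roots and free action off the mirrors -/

section PositiveRoots

variable {E : Type*} [NormedAddCommGroup E] [InnerProductSpace ℝ E]

/-- The orthogonal reflection in the hyperplane orthogonal to `α`. -/
noncomputable abbrev refl (α : E) : E ≃ₗᵢ[ℝ] E := (ℝ ∙ α)ᗮ.reflection

theorem refl_apply {α : E} (hα : ‖α‖ = 1) (x : E) : refl α x = x - (2 * ⟪α, x⟫) • α := by
  rw [refl, Submodule.reflection_orthogonal_apply, Submodule.reflection_singleton_apply]
  simp [hα, two_smul, two_mul, add_smul]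

theorem refl_apply_self {α : E} (hα : ‖α‖ = 1) : refl α α = -α := by
  rw [refl_apply hα, real_inner_self_eq_norm_sq, hα]
  module

theorem refl_mul_self (α : E) : refl α * refl α = 1 := by
  ext x
  simp [refl]

theorem refl_inv (α : E) : (refl α)⁻¹ = refl α :=
  inv_eq_of_mul_eq_one_left (refl_mul_self α)

theorem refl_map {α : E} (hα : ‖α‖ = 1) (w : E ≃ₗᵢ[ℝ] E) :
    refl (w α) = w * refl α * w⁻¹ := by
  have hw : ‖w α‖ = 1 := by rw [w.norm_map, hα]
  ext x
  obtain ⟨y, rfl⟩ := w.surjective x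
  have h : w⁻¹ (w y) = y := w.symm_apply_apply y
  change _ = w (refl α (w⁻¹ (w y)))
  rw [refl_apply hw, h, refl_apply hα, map_sub, map_smul, w.inner_map_map]

/-- The unit normals of the reflections in `G` that lie on the same side as `p`. -/
def posRoots (G : Subgroup (E ≃ₗᵢ[ℝ] E)) (p : E) : Set E :=
  {α | ‖α‖ = 1 ∧ refl α ∈ G ∧ 0 < ⟪α, p⟫}

theorem finite_posRoots (G : Subgroup (E ≃ₗᵢ[ℝ] E)) [Finite G] (p : E) :
    (posRoots G p).Finite := by
  have hG : (G : Set (E ≃ₗᵢ[ℝ] E)).Finite := Set.toFinite _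
  refine Set.Finite.of_finite_image (f := refl) (hG.subset ?_) ?_
  · rintro _ ⟨α, hα, rfl⟩
    exact hα.2.1
  · intro α hα β hβ h
    have h1 : refl α p = refl β p := by rw [h]
    rw [refl_apply hα.1, refl_apply hβ.1] at h1
    -- The displacement of p recovers α: it is a multiple of a unit vector by a positive factor.
    have h2 : (2 * ⟪α, p⟫) • α = (2 * ⟪β, p⟫) • β := by simpa using h1
    have h3 := congrArg norm h2
    rw [norm_smul, norm_smul, hα.1, hβ.1, Real.norm_eq_abs, Real.norm_eq_abs,
      abs_of_pos (by linarith [hα.2.2]), abs_of_pos (by linarith [hβ.2.2]), mul_one, mul_one] at h3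
    rw [← h3] at h2
    have h4 : 2 * ⟪α, p⟫ ≠ 0 := ne_of_gt (by linarith [hα.2.2])
    exact smul_right_injective E h4 h2

theorem refl_neg (α : E) : refl (-α) = refl α := by
  have : (ℝ ∙ (-α)) = (ℝ ∙ α) := by
    rw [← Set.neg_singleton, Submodule.span_neg]
  simp only [refl, this]

theorem refl_map_mem {G : Subgroup (E ≃ₗᵢ[ℝ] E)} {α : E} (hα : ‖α‖ = 1) (hG : refl α ∈ G)
    {w : E ≃ₗᵢ[ℝ] E} (hw : w ∈ G) : refl (w α) ∈ G := by
  rw [refl_map hα]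
  exact G.mul_mem (G.mul_mem hw hG) (G.inv_mem hw)

variable {G : Subgroup (E ≃ₗᵢ[ℝ] E)} {p : E}

theorem map_mem_posRoots_of_pos {α : E} (hα : α ∈ posRoots G p) {w : E ≃ₗᵢ[ℝ] E} (hw : w ∈ G)
    (h : 0 < ⟪w α, p⟫) : w α ∈ posRoots G p :=
  ⟨by rw [w.norm_map, hα.1], refl_map_mem hα.1 hα.2.1 hw, h⟩

theorem neg_map_mem_posRoots_of_neg {α : E} (hα : α ∈ posRoots G p) {w : E ≃ₗᵢ[ℝ] E}
    (hw : w ∈ G) (h : ⟪w α, p⟫ < 0) : -w α ∈ posRoots G p :=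
  ⟨by rw [norm_neg, w.norm_map, hα.1], by rw [refl_neg]; exact refl_map_mem hα.1 hα.2.1 hw,
    by rw [inner_neg_left]; linarith⟩

theorem inner_map_ne_zero (hp : ∀ α : E, α ≠ 0 → refl α ∈ G → ⟪α, p⟫ ≠ 0) {α : E}
    (hα : α ∈ posRoots G p) {w : E ≃ₗᵢ[ℝ] E} (hw : w ∈ G) : ⟪w α, p⟫ ≠ 0 := by
  refine hp _ ?_ (refl_map_mem hα.1 hα.2.1 hw)
  rw [← norm_ne_zero_iff, w.norm_map, hα.1]
  exact one_ne_zero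

/-- `β` is a combination of elements of `Δ` with nonnegative coefficients. -/
def InCone (Δ : Finset E) (β : E) : Prop :=
  ∃ c : E → ℝ, (∀ δ, 0 ≤ c δ) ∧ β = ∑ δ ∈ Δ, c δ • δ

theorem inCone_of_mem [DecidableEq E] {Δ : Finset E} {β : E} (h : β ∈ Δ) : InCone Δ β :=
  ⟨fun δ => if δ = β then 1 else 0, fun δ => by dsimp only; split_ifs <;> norm_num,
    by simp [h]⟩

/-- A minimal set of positive roots whose cone contains all positive roots. -/
theorem exists_minimal_cone_generators [Finite G] :
    ∃ Δ : Finset E, ↑Δ ⊆ posRoots G p ∧ (∀ β ∈ posRoots G p, InCone Δ β) ∧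
      ∀ Δ' : Finset E, Δ' ⊂ Δ → ¬ ∀ β ∈ posRoots G p, InCone Δ' β := by
  classical
  let S : Set (Finset E) := {Δ | ↑Δ ⊆ posRoots G p ∧ ∀ β ∈ posRoots G p, InCone Δ β}
  have hS : S.Nonempty := by
    refine ⟨(finite_posRoots G p).toFinset, by simp, fun β hβ => inCone_of_mem ?_⟩
    simpa using hβ
  obtain ⟨Δ, hΔ, hmin⟩ := (wellFounded_lt (α := Finset E)).has_min S hS
  exact ⟨Δ, hΔ.1, hΔ.2, fun Δ' h h' =>
    hmin Δ' ⟨(Finset.coe_subset.2 h.subset).trans hΔ.1, h'⟩ h⟩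

/-- Pairing with p serves in place of linear independence of the simple roots. -/
theorem inner_sum_pos {Δ : Finset E} (hΔ : ↑Δ ⊆ posRoots G p) {k : E → ℝ}
    (hk : ∀ δ, 0 ≤ k δ) (hne : ∃ δ ∈ Δ, k δ ≠ 0) : 0 < ⟪∑ δ ∈ Δ, k δ • δ, p⟫ := by
  rw [sum_inner]
  simp only [real_inner_smul_left]
  obtain ⟨δ, hδ, h⟩ := hne
  exact Finset.sum_pos' (fun x hx => mul_nonneg (hk x) (hΔ hx).2.2.le)
    ⟨δ, hδ, mul_pos (lt_of_le_of_ne (hk δ) h.symm) (hΔ hδ).2.2⟩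

/-- A simple reflection sends every positive root other than its own to a positive root. -/
theorem inner_refl_pos_of_minimal (hp : ∀ α : E, α ≠ 0 → refl α ∈ G → ⟪α, p⟫ ≠ 0)
    {Δ : Finset E} (hΔ : ↑Δ ⊆ posRoots G p) (hcone : ∀ β ∈ posRoots G p, InCone Δ β)
    (hmin : ∀ Δ' : Finset E, Δ' ⊂ Δ → ¬ ∀ β ∈ posRoots G p, InCone Δ' β)
    {α : E} (hα : α ∈ Δ) {β : E} (hβ : β ∈ posRoots G p) (hne : β ≠ α) :
    0 < ⟪refl α β, p⟫ := by
  classical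
  by_contra hcon
  have hα' := hΔ hα
  have hneg : ⟪refl α β, p⟫ < 0 :=
    lt_of_le_of_ne (not_lt.1 hcon) (inner_map_ne_zero hp hβ hα'.2.1)
  obtain ⟨c, hc, hcβ⟩ := hcone β hβ
  obtain ⟨d, hd, hdβ⟩ := hcone _ (neg_map_mem_posRoots_of_neg hβ hα'.2.1 hneg)
  have hsub : ↑(Δ.erase α) ⊆ posRoots G p :=
    (Finset.coe_subset.2 (Finset.erase_subset α Δ)).trans hΔ
  rw [← Finset.add_sum_erase Δ _ hα] at hcβ hdβ
  -- If `refl α β` were negative, β and `-refl α β` would both lie in the cone. Adding their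
  -- expansions leaves e • α as a nonnegative combination of the other generators; e > 0 then makes
  -- α redundant, against minimality.
  set e : ℝ := 2 * ⟪α, β⟫ - c α - d α with he
  have hsum : ∑ δ ∈ Δ.erase α, (c δ + d δ) • δ = e • α := by
    have h1 : ∑ δ ∈ Δ.erase α, (c δ + d δ) • δ
        = (∑ δ ∈ Δ.erase α, c δ • δ) + ∑ δ ∈ Δ.erase α, d δ • δ := by
      simp only [add_smul, Finset.sum_add_distrib]
    have h2 : ∑ δ ∈ Δ.erase α, c δ • δ = β - c α • α := eq_sub_of_add_eq' hcβ.symm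
    have h3 : ∑ δ ∈ Δ.erase α, d δ • δ = -refl α β - d α • α := eq_sub_of_add_eq' hdβ.symm
    rw [h1, h2, h3, refl_apply hα'.1, he]
    module
  have hex : ∃ δ ∈ Δ.erase α, c δ + d δ ≠ 0 := by
    by_contra! h
    have h0 : ∀ δ ∈ Δ.erase α, c δ • δ = 0 := fun δ hδ => by
      have : c δ = 0 := by linarith [h δ hδ, hc δ, hd δ]
      rw [this, zero_smul]
    rw [Finset.sum_eq_zero h0, add_zero] at hcβ
    apply hne
    have hn := congrArg norm hcβ
    rw [norm_smul, hα'.1, hβ.1, Real.norm_eq_abs, abs_of_nonneg (hc α), mul_one] at hn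
    rw [hcβ, ← hn, one_smul]
  have he_pos : 0 < e := by
    have h := inner_sum_pos hsub (fun δ => add_nonneg (hc δ) (hd δ)) hex
    rw [hsum, real_inner_smul_left] at h
    exact pos_of_mul_pos_left h hα'.2.2.le
  have hαeq : α = ∑ δ ∈ Δ.erase α, (e⁻¹ * (c δ + d δ)) • δ := by
    simp only [mul_smul]
    rw [← Finset.smul_sum, hsum, smul_smul, inv_mul_cancel₀ he_pos.ne', one_smul]
  refine hmin _ (Finset.erase_ssubset hα) fun γ hγ => ?_
  obtain ⟨k, hk, hkγ⟩ := hcone γ hγ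
  refine ⟨fun δ => k α * (e⁻¹ * (c δ + d δ)) + k δ, fun δ => ?_, ?_⟩
  · have := hk α; have := hk δ; have := hc δ; have := hd δ
    positivity
  · rw [hkγ, ← Finset.add_sum_erase Δ _ hα]
    simp only [add_smul, Finset.sum_add_distrib, mul_smul (k α)]
    rw [← Finset.smul_sum, ← hαeq]

/-- Simple roots of a reflection group with respect to a point `p` off its mirrors. -/
structure IsSimpleSystem (G : Subgroup (E ≃ₗᵢ[ℝ] E)) (p : E) (Δ : Finset E) : Prop where
  subset : ↑Δ ⊆ posRoots G p
  cone : ∀ β ∈ posRoots G p, InCone Δ β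
  refl_pos : ∀ α ∈ Δ, ∀ β ∈ posRoots G p, β ≠ α → 0 < ⟪refl α β, p⟫

theorem exists_isSimpleSystem [Finite G] (hp : ∀ α : E, α ≠ 0 → refl α ∈ G → ⟪α, p⟫ ≠ 0) :
    ∃ Δ : Finset E, IsSimpleSystem G p Δ := by
  obtain ⟨Δ, h1, h2, h3⟩ := exists_minimal_cone_generators (G := G) (p := p)
  exact ⟨Δ, h1, h2, fun α hα β hβ hne => inner_refl_pos_of_minimal hp h1 h2 h3 hα hβ hne⟩

/-- Every reflection of `G` lies in the subgroup generated by the simple reflections. -/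
theorem IsSimpleSystem.refl_mem_closure [Finite G] {Δ : Finset E} (hΔ : IsSimpleSystem G p Δ)
    {γ : E} (hγ : γ ∈ posRoots G p) : refl γ ∈ Subgroup.closure (refl '' (Δ : Set E)) := by
  set K := Subgroup.closure (refl '' (Δ : Set E)) with hK
  let S : Set E := {β | β ∈ posRoots G p ∧ ∃ w ∈ K, β = w γ}
  have hSfin : S.Finite := (finite_posRoots G p).subset fun β hβ => hβ.1
  have hSne : S.Nonempty := ⟨γ, hγ, 1, K.one_mem, rfl⟩
  -- Take the lowest positive root in the K-orbit of γ. Some simple δ has positive product with it,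
  -- and reflecting in δ would give a lower positive root unless β = δ.
  obtain ⟨β, ⟨hβ, w, hw, hβw⟩, hmin⟩ := Set.exists_min_image S (fun β => ⟪β, p⟫) hSfin hSne
  obtain ⟨δ, hδ, hpos⟩ : ∃ δ ∈ Δ, 0 < ⟪δ, β⟫ := by
    by_contra! h
    obtain ⟨c, hc, hcβ⟩ := hΔ.cone β hβ
    have h1 : ⟪β, β⟫ ≤ 0 := by
      nth_rewrite 1 [hcβ]
      rw [sum_inner]
      refine Finset.sum_nonpos fun δ hδ => ?_
      rw [real_inner_smul_left]
      exact mul_nonpos_of_nonneg_of_nonpos (hc δ) (h δ hδ)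
    rw [real_inner_self_eq_norm_sq, hβ.1] at h1
    norm_num at h1
  have hδK : refl δ ∈ K := Subgroup.subset_closure ⟨δ, hδ, rfl⟩
  have hδ' := hΔ.subset hδ
  have hβK : refl β ∈ K := by
    by_cases hne : β = δ
    · rwa [hne]
    · exfalso
      have h1 := hΔ.refl_pos δ hδ β hβ hne
      have h2 : refl δ β ∈ S :=
        ⟨map_mem_posRoots_of_pos hβ hδ'.2.1 h1, refl δ * w, K.mul_mem hδK hw, by rw [hβw]; rfl⟩
      have h3 := hmin _ h2
      simp only [refl_apply hδ'.1, inner_sub_left, real_inner_smul_left] at h3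
      have h4 : 0 < 2 * ⟪δ, β⟫ * ⟪δ, p⟫ := mul_pos (by linarith) hδ'.2.2
      linarith
  have h5 : refl γ = w⁻¹ * refl β * w := by
    rw [hβw, refl_map hγ.1]
    group
  rw [h5]
  exact K.mul_mem (K.mul_mem (K.inv_mem hw) hβK) hw

theorem prod_refl_mem {Δ : Finset E} (hΔ : ↑Δ ⊆ posRoots G p) (l : List E)
    (hl : ∀ δ ∈ l, δ ∈ Δ) : (l.map refl).prod ∈ G := by
  refine Subgroup.list_prod_mem G fun x hx => ?_
  obtain ⟨δ, hδ, rfl⟩ := List.mem_map.1 hx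
  exact (hΔ (hl δ hδ)).2.1

/-- Exchange: if a product of simple reflections makes the simple root `β` negative, then
multiplying it by the reflection in `β` deletes one factor. -/
theorem IsSimpleSystem.exchange (hp : ∀ α : E, α ≠ 0 → refl α ∈ G → ⟪α, p⟫ ≠ 0)
    {Δ : Finset E} (hΔ : IsSimpleSystem G p Δ) {β : E} (hβ : β ∈ Δ) (l : List E)
    (hl : ∀ δ ∈ l, δ ∈ Δ) (h : ⟪(l.map refl).prod β, p⟫ < 0) :
    ∃ l' : List E, (∀ δ ∈ l', δ ∈ Δ) ∧ l'.length < l.length ∧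
      (l.map refl).prod * refl β = (l'.map refl).prod := by
  have hβ' := hΔ.subset hβ
  induction l with
  | nil =>
    have h1 : ⟪β, p⟫ < 0 := by simpa using h
    exact absurd hβ'.2.2 h1.not_gt
  | cons a l ih =>
    have ha : a ∈ Δ := hl a (by simp)
    have hl' : ∀ δ ∈ l, δ ∈ Δ := fun δ hδ => hl δ (by simp [hδ])
    have hlG := prod_refl_mem hΔ.subset l hl'
    rw [List.map_cons, List.prod_cons] at h ⊢
    rcases lt_or_gt_of_ne (inner_map_ne_zero hp hβ' hlG) with hneg | hpos
    · obtain ⟨l', h1, h2, h3⟩ := ih hl' hneg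
      refine ⟨a :: l', ?_, by simpa using h2, ?_⟩
      · intro δ hδ
        rcases List.mem_cons.1 hδ with rfl | hδ
        exacts [ha, h1 δ hδ]
      · rw [List.map_cons, List.prod_cons, mul_assoc, h3]
    -- The sign changes exactly at the letter a, and a is the only positive root that `refl a` makes
    -- negative.
    · have heq : (l.map refl).prod β = a := by
        by_contra hne
        exact absurd h
          (hΔ.refl_pos a ha _ (map_mem_posRoots_of_pos hβ' hlG hpos) hne).not_gt
      refine ⟨l, hl', by simp, ?_⟩
      rw [← heq, refl_map hβ'.1, inv_mul_cancel_right, mul_assoc, refl_mul_self, mul_one]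

/-- Descent on word length: an isometry fixing p preserves the sign of its last letter β, so the
word without β makes β negative, and exchange yields a shorter word for the same element. -/
theorem IsSimpleSystem.prod_eq_one (hp : ∀ α : E, α ≠ 0 → refl α ∈ G → ⟪α, p⟫ ≠ 0)
    {Δ : Finset E} (hΔ : IsSimpleSystem G p Δ) (k : ℕ) (l : List E) (hk : l.length ≤ k)
    (hl : ∀ δ ∈ l, δ ∈ Δ) (h : (l.map refl).prod p = p) : (l.map refl).prod = 1 := by
  induction k generalizing l with
  | zero =>
    rw [List.length_eq_zero_iff.1 (Nat.le_zero.1 hk)]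
    rfl
  | succ k ih =>
    rcases List.eq_nil_or_concat l with rfl | ⟨l₁, β, rfl⟩
    · rfl
    rw [List.concat_eq_append] at *
    have hprod : ((l₁ ++ [β]).map refl).prod = (l₁.map refl).prod * refl β := by simp
    have hβ : β ∈ Δ := hl β (by simp)
    have hβ' := hΔ.subset hβ
    have hl₁ : ∀ δ ∈ l₁, δ ∈ Δ := fun δ hδ => hl δ (by simp [hδ])
    rw [hprod] at h ⊢
    have hneg : ⟪(l₁.map refl).prod β, p⟫ < 0 := by
      have h1 : ⟪((l₁.map refl).prod * refl β) β, p⟫ = ⟪β, p⟫ := by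
        have h0 := ((l₁.map refl).prod * refl β).inner_map_map β p
        rwa [h] at h0
      have h2 : ((l₁.map refl).prod * refl β) β = -(l₁.map refl).prod β := by
        change (l₁.map refl).prod (refl β β) = _
        rw [refl_apply_self hβ'.1, map_neg]
      rw [h2, inner_neg_left] at h1
      linarith [hβ'.2.2]
    obtain ⟨l', h1, h2, h3⟩ := hΔ.exchange hp hβ l₁ hl₁ hneg
    rw [h3] at h ⊢
    refine ih l' ?_ h1 h
    simp only [List.length_append, List.length_singleton] at hk
    omega

/-- A finite group generated by reflections acts freely off its mirrors. -/
theorem eq_one_of_apply_eq_self [Finite G]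
    (hgen : G ≤ Subgroup.closure {g | g ∈ G ∧ ∃ v : E, v ≠ 0 ∧ g = refl v})
    (hp : ∀ α : E, α ≠ 0 → refl α ∈ G → ⟪α, p⟫ ≠ 0) {g : E ≃ₗᵢ[ℝ] E} (hg : g ∈ G)
    (hgp : g p = p) : g = 1 := by
  obtain ⟨Δ, hΔ⟩ := exists_isSimpleSystem hp
  have hle : Subgroup.closure {g | g ∈ G ∧ ∃ v : E, v ≠ 0 ∧ g = refl v}
      ≤ Subgroup.closure (refl '' (Δ : Set E)) := by
    rw [Subgroup.closure_le]
    rintro _ ⟨hG, v, hv, rfl⟩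
    have hspan : ∀ r : ℝ, r ≠ 0 → refl (r • v) = refl v := fun r hr => by
      simp only [refl, Submodule.span_singleton_smul_eq (IsUnit.mk0 r hr)]
    have hn : ‖v‖ ≠ 0 := norm_ne_zero_iff.2 hv
    have hunit : ‖‖v‖⁻¹ • v‖ = 1 := norm_smul_inv_norm hv
    rcases lt_or_gt_of_ne (hp v hv hG) with hneg | hpos
    · have h1 : refl (-(‖v‖⁻¹ • v)) = refl v := by rw [refl_neg, hspan _ (inv_ne_zero hn)]
      rw [← h1]
      refine hΔ.refl_mem_closure ⟨by rw [norm_neg, hunit], by rw [h1]; exact hG, ?_⟩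
      rw [inner_neg_left, real_inner_smul_left, neg_pos]
      exact mul_neg_of_pos_of_neg (inv_pos.2 (norm_pos_iff.2 hv)) hneg
    · have h1 : refl (‖v‖⁻¹ • v) = refl v := hspan _ (inv_ne_zero hn)
      rw [← h1]
      refine hΔ.refl_mem_closure ⟨hunit, by rw [h1]; exact hG, ?_⟩
      rw [real_inner_smul_left]
      exact mul_pos (inv_pos.2 (norm_pos_iff.2 hv)) hpos
  have hlist : ∃ l : List E, (∀ δ ∈ l, δ ∈ Δ) ∧ (l.map refl).prod = g := by
    refine Subgroup.closure_induction_left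
      (p := fun g _ => ∃ l : List E, (∀ δ ∈ l, δ ∈ Δ) ∧ (l.map refl).prod = g)
      ⟨[], by simp, rfl⟩ ?_ ?_ (hle (hgen hg))
    · rintro _ ⟨δ, hδ, rfl⟩ y _ ⟨l, hl, rfl⟩
      exact ⟨δ :: l, by simpa using ⟨hδ, hl⟩, by simp⟩
    · rintro _ ⟨δ, hδ, rfl⟩ y _ ⟨l, hl, rfl⟩
      exact ⟨δ :: l, by simpa using ⟨hδ, hl⟩, by rw [refl_inv]; simp⟩
  obtain ⟨l, hl, rfl⟩ := hlist
  exact hΔ.prod_eq_one hp l.length l le_rfl hl hgp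

end PositiveRoots

/-! ### Invariant polynomials near a point with trivial stabilizer -/

section PolynomialMaps

variable {n : ℕ}

theorem contDiff_evalAt (f : MvPolynomial (Fin n) ℝ) :
    ContDiff ℝ 1 (fun x : EuclideanSpace ℝ (Fin n) => evalAt x f) := by
  have h := AnalyticOnNhd.eval_continuousLinearMap'
    (fun i => (EuclideanSpace.proj i : EuclideanSpace ℝ (Fin n) →L[ℝ] ℝ)) f
  exact h.contDiff

theorem differentiable_evalAt (f : MvPolynomial (Fin n) ℝ) :
    Differentiable ℝ (fun x : EuclideanSpace ℝ (Fin n) => evalAt x f) :=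
  (contDiff_evalAt f).differentiable one_ne_zero

theorem evalAt_add (x : EuclideanSpace ℝ (Fin n)) (f g : MvPolynomial (Fin n) ℝ) :
    evalAt x (f + g) = evalAt x f + evalAt x g := map_add _ _ _

theorem evalAt_mul (x : EuclideanSpace ℝ (Fin n)) (f g : MvPolynomial (Fin n) ℝ) :
    evalAt x (f * g) = evalAt x f * evalAt x g := map_mul _ _ _

theorem evalAt_sum {ι : Type*} (x : EuclideanSpace ℝ (Fin n)) (s : Finset ι)
    (f : ι → MvPolynomial (Fin n) ℝ) :
    evalAt x (∑ i ∈ s, f i) = ∑ i ∈ s, evalAt x (f i) := map_sum _ _ _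

theorem evalAt_prod {ι : Type*} (x : EuclideanSpace ℝ (Fin n)) (s : Finset ι)
    (f : ι → MvPolynomial (Fin n) ℝ) :
    evalAt x (∏ i ∈ s, f i) = ∏ i ∈ s, evalAt x (f i) := map_prod _ _ _

theorem evalAt_algebraMap (x : EuclideanSpace ℝ (Fin n)) (r : ℝ) :
    evalAt x (algebraMap ℝ (MvPolynomial (Fin n) ℝ) r) = r := by
  simp [evalAt, MvPolynomial.algebraMap_eq]

/-- The polynomial whose value at `x` is the squared distance from `x` to `y`. -/
noncomputable def sqDistPoly (y : EuclideanSpace ℝ (Fin n)) : MvPolynomial (Fin n) ℝ :=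
  ∑ i, (MvPolynomial.X i - MvPolynomial.C (y i)) ^ 2

theorem evalAt_sqDistPoly (y x : EuclideanSpace ℝ (Fin n)) :
    evalAt x (sqDistPoly y) = ‖x - y‖ ^ 2 := by
  simp [evalAt, sqDistPoly, EuclideanSpace.norm_sq_eq]

/-- The polynomial whose value at `x` is the inner product of `v` and `x - p`. -/
noncomputable def innerPoly (v p : EuclideanSpace ℝ (Fin n)) : MvPolynomial (Fin n) ℝ :=
  ∑ i, MvPolynomial.C (v i) * (MvPolynomial.X i - MvPolynomial.C (p i))

theorem evalAt_innerPoly (v p x : EuclideanSpace ℝ (Fin n)) :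
    evalAt x (innerPoly v p) = ⟪v, x - p⟫ := by
  simp [evalAt, innerPoly, PiLp.inner_apply, mul_comm]

/-- Substitution of a linear map into a polynomial. -/
noncomputable def compPoly (g : EuclideanSpace ℝ (Fin n) ≃ₗᵢ[ℝ] EuclideanSpace ℝ (Fin n))
    (f : MvPolynomial (Fin n) ℝ) : MvPolynomial (Fin n) ℝ :=
  MvPolynomial.bind₁
    (fun i => ∑ k, MvPolynomial.C (g (EuclideanSpace.single k 1) i) * MvPolynomial.X k) f

theorem evalAt_compPoly (g : EuclideanSpace ℝ (Fin n) ≃ₗᵢ[ℝ] EuclideanSpace ℝ (Fin n))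
    (f : MvPolynomial (Fin n) ℝ) (x : EuclideanSpace ℝ (Fin n)) :
    evalAt x (compPoly g f) = evalAt (g x) f := by
  have hx : x = ∑ k, x k • EuclideanSpace.single k (1 : ℝ) := by
    ext i
    simp [Finset.sum_apply, Pi.single_apply]
  have hgx : ∀ i, g x i = ∑ k, g (EuclideanSpace.single k 1) i * x k := fun i => by
    conv_lhs => rw [hx]
    simp [mul_comm]
  have h := MvPolynomial.eval₂Hom_bind₁ (RingHom.id ℝ) (fun i => x i)
    (fun i => ∑ k, MvPolynomial.C (g (EuclideanSpace.single k 1) i) * MvPolynomial.X k) f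
  refine h.trans ?_
  simp only [evalAt, MvPolynomial.eval]
  congr 2
  ext i
  rw [hgx i]
  simp

/-- The sum of the translates of a polynomial is invariant. -/
theorem sum_compPoly_mem_invariants
    (G : Subgroup (EuclideanSpace ℝ (Fin n) ≃ₗᵢ[ℝ] EuclideanSpace ℝ (Fin n))) [Fintype G]
    (q : MvPolynomial (Fin n) ℝ) : ∑ g : G, compPoly g.1 q ∈ invariants G := by
  intro g hg x
  rw [evalAt_sum, evalAt_sum]
  simp only [evalAt_compPoly]
  exact Fintype.sum_equiv (Equiv.mulRight (⟨g, hg⟩ : G)⁻¹) _ _ fun h => rfl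

theorem sqDistPoly_zero_mem_invariants
    (G : Subgroup (EuclideanSpace ℝ (Fin n) ≃ₗᵢ[ℝ] EuclideanSpace ℝ (Fin n))) :
    sqDistPoly 0 ∈ invariants G := by
  intro g _ x
  rw [evalAt_sqDistPoly, evalAt_sqDistPoly, sub_zero, sub_zero, LinearIsometryEquiv.norm_map]

/-- If a direction is annihilated by the differentials at `p` of all the generators, then it is
annihilated by the differential of every element of the algebra. -/
theorem fderiv_evalAt_eq_zero_of_mem_adjoin {s : Set (MvPolynomial (Fin n) ℝ)}
    {p v : EuclideanSpace ℝ (Fin n)} (h : ∀ f ∈ s, fderiv ℝ (fun x => evalAt x f) p v = 0)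
    {f : MvPolynomial (Fin n) ℝ} (hf : f ∈ Algebra.adjoin ℝ s) :
    fderiv ℝ (fun x => evalAt x f) p v = 0 := by
  induction hf using Algebra.adjoin_induction with
  | mem f hf => exact h f hf
  | algebraMap r =>
    simp only [evalAt_algebraMap]
    simp
  | add f g _ _ hf hg =>
    simp only [evalAt_add]
    rw [fderiv_fun_add (differentiable_evalAt f p) (differentiable_evalAt g p)]
    simp [hf, hg]
  | mul f g _ _ hf hg =>
    simp only [evalAt_mul]
    rw [fderiv_fun_mul (differentiable_evalAt f p) (differentiable_evalAt g p)]
    simp [hf, hg]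

/-- Invariant polynomials of a finite group separate tangent directions at a point with trivial
stabilizer. -/
theorem exists_invariant_fderiv_ne_zero
    (G : Subgroup (EuclideanSpace ℝ (Fin n) ≃ₗᵢ[ℝ] EuclideanSpace ℝ (Fin n))) [Finite G]
    {p v : EuclideanSpace ℝ (Fin n)} (hp : ∀ g ∈ G, g p = p → g = 1) (hv : v ≠ 0) :
    ∃ F ∈ invariants G, fderiv ℝ (fun x => evalAt x F) p v ≠ 0 := by
  classical
  have : Fintype G := Fintype.ofFinite G
  let M : Finset G → MvPolynomial (Fin n) ℝ := fun s => ∏ h ∈ s, sqDistPoly (h.1 p)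
  -- The differential of q vanishes at every orbit point other than p, while at p it is nonzero on
  -- v. Hence only the identity term survives when the average over G is differentiated at p.
  let q : MvPolynomial (Fin n) ℝ := innerPoly v p * M (Finset.univ.erase 1)
  have hsq : ∀ y : EuclideanSpace ℝ (Fin n),
      HasFDerivAt (fun x => evalAt x (sqDistPoly y)) (0 : _ →L[ℝ] ℝ) y := fun y => by
    simp only [evalAt_sqDistPoly]
    have h := ((hasFDerivAt_id y).sub_const y).norm_sq
    simpa using h
  have hq : ∀ g : G, g ≠ 1 → fderiv ℝ (fun x => evalAt x q) (g.1 p) = 0 := by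
    intro g hg
    set y := g.1 p with hy
    let r := innerPoly v p * M ((Finset.univ.erase 1).erase g)
    have hqr : q = sqDistPoly y * r := by
      have : M (Finset.univ.erase 1) = sqDistPoly y * M ((Finset.univ.erase 1).erase g) :=
        (Finset.mul_prod_erase _ _ (Finset.mem_erase.2 ⟨hg, Finset.mem_univ g⟩)).symm
      simp only [q, r, this]
      ring
    rw [hqr]
    simp only [evalAt_mul]
    rw [((hsq y).fun_mul (differentiable_evalAt r y).hasFDerivAt).fderiv]
    simp [evalAt_sqDistPoly]
  have hM : evalAt p (M (Finset.univ.erase 1)) ≠ 0 := by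
    simp only [M, evalAt_prod, evalAt_sqDistPoly]
    refine Finset.prod_ne_zero_iff.2 fun h hh => ?_
    have hne : h ≠ 1 := (Finset.mem_erase.1 hh).1
    refine pow_ne_zero 2 (norm_ne_zero_iff.2 (sub_ne_zero.2 fun heq => hne ?_))
    exact Subtype.ext (hp h h.2 heq.symm)
  have hq1 : fderiv ℝ (fun x => evalAt x q) p v
      = evalAt p (M (Finset.univ.erase 1)) * ‖v‖ ^ 2 := by
    have hin : HasFDerivAt (fun x => evalAt x (innerPoly v p)) (innerSL ℝ v) p := by
      simp only [evalAt_innerPoly]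
      exact (innerSL ℝ v).hasFDerivAt.comp p ((hasFDerivAt_id p).sub_const p)
    simp only [q, evalAt_mul]
    rw [(hin.fun_mul (differentiable_evalAt (M (Finset.univ.erase 1)) p).hasFDerivAt).fderiv]
    simp [evalAt_innerPoly]
  refine ⟨_, sum_compPoly_mem_invariants G q, ?_⟩
  have hsum : fderiv ℝ (fun x => evalAt x (∑ g : G, compPoly g.1 q)) p v
      = ∑ g : G, fderiv ℝ (fun x => evalAt x q) (g.1 p) (g.1 v) := by
    simp only [evalAt_sum, evalAt_compPoly]
    have h : ∀ g ∈ (Finset.univ : Finset G),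
        HasFDerivAt (fun x => evalAt (g.1 x) q)
          ((fderiv ℝ (fun x => evalAt x q) (g.1 p)).comp
            (g.1.toContinuousLinearEquiv : _ →L[ℝ] _)) p := fun g _ =>
      HasFDerivAt.comp (f := g.1) p (differentiable_evalAt q _).hasFDerivAt
        g.1.toContinuousLinearEquiv.hasFDerivAt
    rw [(HasFDerivAt.fun_sum h).fderiv]
    simp
  rw [hsum, Finset.sum_eq_single 1]
  · change fderiv ℝ (fun x => evalAt x q) p v ≠ 0
    rw [hq1]
    exact mul_ne_zero hM (pow_ne_zero 2 (norm_ne_zero_iff.2 hv))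
  · intro g _ hg
    rw [hq g hg]
    rfl
  · simp

/-- The map whose coordinates are the polynomials `π i`. -/
noncomputable def polyMap (π : Fin n → MvPolynomial (Fin n) ℝ) (x : EuclideanSpace ℝ (Fin n)) :
    Fin n → ℝ := fun i => evalAt x (π i)

theorem contDiff_polyMap (π : Fin n → MvPolynomial (Fin n) ℝ) : ContDiff ℝ 1 (polyMap π) :=
  contDiff_pi.2 fun i => contDiff_evalAt (π i)

/-- Generators of the invariant ring define a map that is open at every point with trivial
stabilizer. -/
theorem map_nhds_polyMap
    {G : Subgroup (EuclideanSpace ℝ (Fin n) ≃ₗᵢ[ℝ] EuclideanSpace ℝ (Fin n))} [Finite G]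
    {π : Fin n → MvPolynomial (Fin n) ℝ} (hπ : Algebra.adjoin ℝ (Set.range π) = invariants G)
    {p : EuclideanSpace ℝ (Fin n)} (hp : ∀ g ∈ G, g p = p → g = 1) :
    Filter.map (polyMap π) (nhds p) = nhds (polyMap π p) := by
  have hstrict : HasStrictFDerivAt (polyMap π) (fderiv ℝ (polyMap π) p) p :=
    (contDiff_polyMap π).contDiffAt.hasStrictFDerivAt one_ne_zero
  have hinj : Function.Injective (fderiv ℝ (polyMap π) p) := by
    refine (injective_iff_map_eq_zero _).2 fun v hv => ?_
    by_contra hne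
    obtain ⟨F, hF, hFv⟩ := exists_invariant_fderiv_ne_zero G hp hne
    rw [← hπ] at hF
    refine hFv (fderiv_evalAt_eq_zero_of_mem_adjoin ?_ hF)
    rintro _ ⟨i, rfl⟩
    have h := congrFun hv i
    have h2 := hasFDerivAt_pi'.1 hstrict.hasFDerivAt i
    have h3 : fderiv ℝ (fun x => evalAt x (π i)) p = _ := h2.fderiv
    rw [h3]
    exact h
  have hsurj : Function.Surjective (fderiv ℝ (polyMap π) p) :=
    (LinearMap.injective_iff_surjective_of_finrank_eq_finrank (by simp)).1 hinj
  exact hstrict.map_nhds_eq_of_surj (LinearMap.range_eq_top.2 hsurj)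

end PolynomialMaps

/-! ### The squared norm, properness and lines in the image -/

section EssentialGroups

variable {n : ℕ}

theorem evalAt_smul_of_isHomogeneous {f : MvPolynomial (Fin n) ℝ} {d : ℕ}
    (hf : f.IsHomogeneous d) (t : ℝ) (x : EuclideanSpace ℝ (Fin n)) :
    evalAt (t • x) f = t ^ d * evalAt x f := by
  simp only [evalAt, MvPolynomial.eval_eq', Finset.mul_sum]
  refine Finset.sum_congr rfl fun e he => ?_
  have hdeg : ∑ i, e i = d := by
    have h := hf (MvPolynomial.mem_support_iff.1 he)
    rw [← h, ← Finsupp.degree_eq_sum, Finsupp.degree_eq_weight_one]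
    rfl
  simp only [PiLp.smul_apply, smul_eq_mul, mul_pow, Finset.prod_mul_distrib,
    Finset.prod_pow_eq_pow_sum, hdeg]
  ring

/-- An essential group has no nonzero linear invariants. -/
theorem evalAt_eq_zero_of_isHomogeneous_one
    {G : Subgroup (EuclideanSpace ℝ (Fin n) ≃ₗᵢ[ℝ] EuclideanSpace ℝ (Fin n))}
    (hess : IsEssential G) {f : MvPolynomial (Fin n) ℝ} (hf : f ∈ invariants G)
    (h1 : f.IsHomogeneous 1) (x : EuclideanSpace ℝ (Fin n)) : evalAt x f = 0 := by
  have hlin : ∀ x : EuclideanSpace ℝ (Fin n),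
      evalAt x f = fderiv ℝ (fun y => evalAt y f) 0 x := fun x => by
    have hd := (differentiable_evalAt f 0).hasFDerivAt.hasLineDerivAt x
    have hd' : HasLineDerivAt ℝ (fun y => evalAt y f) (evalAt x f) 0 x := by
      simp only [HasLineDerivAt, zero_add, evalAt_smul_of_isHomogeneous h1, pow_one]
      simpa using (hasDerivAt_id (0 : ℝ)).mul_const (evalAt x f)
    exact hd'.unique hd
  -- The vector representing the linear form f is fixed by G, hence zero.
  set w := (InnerProductSpace.toDual ℝ (EuclideanSpace ℝ (Fin n))).symm
    (fderiv ℝ (fun y => evalAt y f) 0) with hw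
  have hin : ∀ x, ⟪w, x⟫ = evalAt x f := fun x => by
    rw [hlin x, hw, InnerProductSpace.toDual_symm_apply]
  have hfix : ∀ g ∈ G, g w = w := fun g hg => by
    refine ext_inner_right ℝ fun x => ?_
    rw [hin x, ← hf g hg x, ← hin, ← g.inner_map_map w]
    congr 1
    exact (g.apply_symm_apply x).symm
  have hbot := hess (ℝ ∙ w) fun g hg u hu => by
    obtain ⟨r, rfl⟩ := Submodule.mem_span_singleton.1 hu
    rw [map_smul, hfix g hg]
  rw [← hin x, Submodule.span_singleton_eq_bot.1 hbot, inner_zero_left]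

/-- The restriction of a polynomial to the line through `x`, as a polynomial in the parameter. -/
noncomputable def restrictLine (x : EuclideanSpace ℝ (Fin n)) :
    MvPolynomial (Fin n) ℝ →ₐ[ℝ] Polynomial ℝ :=
  MvPolynomial.aeval fun i => Polynomial.C (x i) * Polynomial.X

theorem eval_restrictLine (x : EuclideanSpace ℝ (Fin n)) (f : MvPolynomial (Fin n) ℝ) (t : ℝ) :
    (restrictLine x f).eval t = evalAt (t • x) f := by
  induction f using MvPolynomial.induction_on with
  | C a => simp [restrictLine, evalAt]
  | add f g hf hg => rw [map_add, Polynomial.eval_add, hf, hg, evalAt_add]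
  | mul_X f i hf =>
    rw [map_mul, Polynomial.eval_mul, hf, evalAt_mul]
    congr 1
    simp only [restrictLine, evalAt, MvPolynomial.aeval_X, MvPolynomial.eval_X,
      Polynomial.eval_mul, Polynomial.eval_C, Polynomial.eval_X, PiLp.smul_apply, smul_eq_mul]
    ring

theorem restrictLine_of_isHomogeneous {f : MvPolynomial (Fin n) ℝ} {d : ℕ}
    (hf : f.IsHomogeneous d) (x : EuclideanSpace ℝ (Fin n)) :
    restrictLine x f = Polynomial.C (evalAt x f) * Polynomial.X ^ d := by
  refine Polynomial.funext fun t => ?_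
  rw [eval_restrictLine, evalAt_smul_of_isHomogeneous hf, Polynomial.eval_mul, Polynomial.eval_C,
    Polynomial.eval_pow, Polynomial.eval_X, mul_comm]

theorem coeff_zero_restrictLine (x : EuclideanSpace ℝ (Fin n)) (f : MvPolynomial (Fin n) ℝ) :
    (restrictLine x f).coeff 0 = evalAt 0 f := by
  rw [Polynomial.coeff_zero_eq_eval_zero, eval_restrictLine, zero_smul]

/-- In an algebra generated by homogeneous polynomials without linear ones, the quadratic part of
every element is a linear combination of the generators. -/
theorem coeff_restrictLine_of_mem_adjoin {π : Fin n → MvPolynomial (Fin n) ℝ}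
    (hhom : ∀ i, ∃ d : ℕ, (π i).IsHomogeneous d)
    (hlin : ∀ i, (π i).IsHomogeneous 1 → ∀ x, evalAt x (π i) = 0)
    {f : MvPolynomial (Fin n) ℝ} (hf : f ∈ Algebra.adjoin ℝ (Set.range π)) :
    (∀ x, (restrictLine x f).coeff 1 = 0) ∧
      ∃ a : Fin n → ℝ, ∀ x, (restrictLine x f).coeff 2 = ∑ i, a i * evalAt x (π i) := by
  induction hf using Algebra.adjoin_induction with
  | mem f hf =>
    obtain ⟨i, rfl⟩ := hf
    obtain ⟨d, hd⟩ := hhom i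
    simp only [restrictLine_of_isHomogeneous hd, Polynomial.coeff_C_mul, Polynomial.coeff_X_pow]
    refine ⟨fun x => ?_, Pi.single i (if 2 = d then 1 else 0), fun x => ?_⟩
    · split_ifs with h
      · subst h
        rw [hlin i hd, zero_mul]
      · rw [mul_zero]
    · simp [Pi.single_apply]
  | algebraMap r =>
    refine ⟨fun x => ?_, 0, fun x => ?_⟩ <;>
    · rw [AlgHom.commutes, Polynomial.algebraMap_eq, Polynomial.coeff_C_of_ne_zero (by norm_num)]
      try simp
  | add f g _ _ hf hg =>
    obtain ⟨hf1, a, ha⟩ := hf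
    obtain ⟨hg1, b, hb⟩ := hg
    refine ⟨fun x => by rw [map_add, Polynomial.coeff_add, hf1, hg1, add_zero], a + b, fun x => ?_⟩
    rw [map_add, Polynomial.coeff_add, ha, hb, ← Finset.sum_add_distrib]
    simp [add_mul]
  | mul f g _ _ hf hg =>
    obtain ⟨hf1, a, ha⟩ := hf
    obtain ⟨hg1, b, hb⟩ := hg
    -- The product of the linear parts vanishes, so only constant times quadratic terms remain.
    refine ⟨fun x => ?_, evalAt 0 f • b + evalAt 0 g • a, fun x => ?_⟩
    · rw [map_mul, Polynomial.coeff_mul, Finset.Nat.antidiagonal_succ]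
      simp [hf1, hg1]
    · rw [map_mul, Polynomial.coeff_mul, Finset.Nat.sum_antidiagonal_eq_sum_range_succ_mk]
      simp only [Finset.sum_range_succ, Finset.sum_range_zero, zero_add, Nat.sub_zero, Nat.sub_self,
        Nat.add_one_sub_one, hf1, hg1, ha, hb, coeff_zero_restrictLine, mul_zero, add_zero,
        Finset.mul_sum, Finset.sum_mul, ← Finset.sum_add_distrib, Pi.add_apply, Pi.smul_apply,
        smul_eq_mul]
      exact Finset.sum_congr rfl fun i _ => by ring

/-- The squared norm is a linear combination of basic invariants of an essential group. -/
theorem exists_norm_sq_eq_sum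
    {G : Subgroup (EuclideanSpace ℝ (Fin n) ≃ₗᵢ[ℝ] EuclideanSpace ℝ (Fin n))}
    (hess : IsEssential G) {π : Fin n → MvPolynomial (Fin n) ℝ}
    (hhom : ∀ i, ∃ d : ℕ, (π i).IsHomogeneous d)
    (hπ : Algebra.adjoin ℝ (Set.range π) = invariants G) :
    ∃ a : Fin n → ℝ, ∀ x : EuclideanSpace ℝ (Fin n), ‖x‖ ^ 2 = ∑ i, a i * polyMap π x i := by
  have hmem : ∀ i, π i ∈ invariants G := fun i =>
    hπ ▸ Algebra.subset_adjoin (Set.mem_range_self i)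
  obtain ⟨-, a, ha⟩ := coeff_restrictLine_of_mem_adjoin hhom
    (fun i h x => evalAt_eq_zero_of_isHomogeneous_one hess (hmem i) h x)
    (hπ ▸ sqDistPoly_zero_mem_invariants G)
  refine ⟨a, fun x => ?_⟩
  have h : restrictLine x (sqDistPoly 0) = Polynomial.C (‖x‖ ^ 2) * Polynomial.X ^ 2 := by
    refine Polynomial.funext fun t => ?_
    rw [eval_restrictLine, evalAt_sqDistPoly, sub_zero, norm_smul, mul_pow, Polynomial.eval_mul,
      Polynomial.eval_C, Polynomial.eval_pow, Polynomial.eval_X, mul_comm, Real.norm_eq_abs, sq_abs]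
  simp only [polyMap]
  rw [← ha x, h, Polynomial.coeff_C_mul_X_pow, if_pos rfl]

/-- The basic invariants of an essential group define a proper map. -/
theorem isClosed_range_polyMap {π : Fin n → MvPolynomial (Fin n) ℝ} {a : Fin n → ℝ}
    (ha : ∀ x : EuclideanSpace ℝ (Fin n), ‖x‖ ^ 2 = ∑ i, a i * polyMap π x i) :
    IsClosed (Set.range (polyMap π)) := by
  have hcont : Continuous (polyMap π) := (contDiff_polyMap π).continuous
  have hφ : Continuous fun y : Fin n → ℝ => ∑ i, a i * y i := by fun_prop
  refine (isProperMap_iff_isCompact_preimage.2 ⟨hcont, fun K hK => ?_⟩).isClosedMap.isClosed_range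
  obtain ⟨C, hC⟩ := (hK.image hφ).bddAbove
  refine Metric.isCompact_of_isClosed_isBounded (hK.isClosed.preimage hcont) ?_
  refine Metric.isBounded_iff_subset_closedBall 0 |>.2 ⟨√C, fun x hx => ?_⟩
  rw [mem_closedBall_zero_iff]
  refine Real.le_sqrt_of_sq_le ?_
  rw [ha x]
  exact hC ⟨_, hx, rfl⟩

/-- A point off the stratum of codimension one lies on no mirror. -/
theorem inner_ne_zero_of_notMem_stratum
    {G : Subgroup (EuclideanSpace ℝ (Fin n) ≃ₗᵢ[ℝ] EuclideanSpace ℝ (Fin n))}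
    {p : EuclideanSpace ℝ (Fin n)} (hp : p ∉ stratum G (n - 1)) (α : EuclideanSpace ℝ (Fin n))
    (hα : α ≠ 0) (hG : refl α ∈ G) : ⟪α, p⟫ ≠ 0 := by
  intro h
  have hker : LinearMap.ker ((refl α).toLinearEquiv.toLinearMap - LinearMap.id) = (ℝ ∙ α)ᗮ := by
    ext x
    rw [LinearMap.mem_ker, LinearMap.sub_apply, sub_eq_zero]
    exact Submodule.reflection_eq_self_iff x
  refine hp ⟨(ℝ ∙ α)ᗮ, ⟨{(ℝ ∙ α)ᗮ}, ?_, by simp⟩, ?_, ?_⟩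
  · rintro _ rfl
    exact ⟨refl α, hG, ⟨α, hα, rfl⟩, hker.symm⟩
  · have h1 := Submodule.finrank_add_finrank_orthogonal (ℝ ∙ α)
    rw [finrank_span_singleton hα, finrank_euclideanSpace_fin] at h1
    omega
  · exact Submodule.mem_orthogonal_singleton_iff_inner_right.2 h

theorem evalAt_eq_of_mem_adjoin {s : Set (MvPolynomial (Fin n) ℝ)}
    {x y : EuclideanSpace ℝ (Fin n)} (h : ∀ f ∈ s, evalAt x f = evalAt y f)
    {f : MvPolynomial (Fin n) ℝ} (hf : f ∈ Algebra.adjoin ℝ s) : evalAt x f = evalAt y f := by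
  induction hf using Algebra.adjoin_induction with
  | mem f hf => exact h f hf
  | algebraMap r => rw [evalAt_algebraMap, evalAt_algebraMap]
  | add f g _ _ hf hg => rw [evalAt_add, evalAt_add, hf, hg]
  | mul f g _ _ hf hg => rw [evalAt_mul, evalAt_mul, hf, hg]

/-- No line in a coordinate direction lies in the image of the basic invariants. -/
theorem exists_update_notMem_range_polyMap {π : Fin n → MvPolynomial (Fin n) ℝ} {a : Fin n → ℝ}
    (ha : ∀ x : EuclideanSpace ℝ (Fin n), ‖x‖ ^ 2 = ∑ i, a i * polyMap π x i)
    (c : Fin n → ℝ) (j : Fin n) : ∃ t : ℝ, Function.update c j t ∉ Set.range (polyMap π) := by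
  by_contra! h
  choose x hx using h
  set b : ℝ := ∑ i ∈ Finset.univ.erase j, a i * c i with hb
  have hnorm : ∀ t, ‖x t‖ ^ 2 = a j * t + b := fun t => by
    rw [ha, hx, ← Finset.add_sum_erase _ _ (Finset.mem_univ j), Function.update_self, hb]
    congr 1
    refine Finset.sum_congr rfl fun i hi => ?_
    rw [Function.update_of_ne (Finset.ne_of_mem_erase hi)]
  have haj : a j = 0 := by
    by_contra hne
    -- This parameter would make the squared norm equal to -1.
    have h1 := hnorm ((-b - 1) / a j)
    rw [mul_div_cancel₀ _ hne] at h1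
    nlinarith [sq_nonneg ‖x ((-b - 1) / a j)‖]
  have hball : ∀ t, x t ∈ Metric.closedBall (0 : EuclideanSpace ℝ (Fin n)) √b := fun t => by
    rw [mem_closedBall_zero_iff]
    refine Real.le_sqrt_of_sq_le ?_
    rw [hnorm, haj, zero_mul, zero_add]
  obtain ⟨C, hC⟩ := ((isCompact_closedBall (0 : EuclideanSpace ℝ (Fin n)) √b).image
    (contDiff_evalAt (π j)).continuous).bddAbove
  have h1 := hC ⟨x (C + 1), hball _, rfl⟩
  have h2 : evalAt (x (C + 1)) (π j) = C + 1 := by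
    have := congrFun (hx (C + 1)) j
    rwa [Function.update_self] at this
  simp only [h2] at h1
  linarith

end EssentialGroups

end ReflectionGroups

/-! ### Connectedness of the line -/

theorem theorem1p3 {n m : ℕ}
    (G : Subgroup (EuclideanSpace ℝ (Fin n) ≃ₗᵢ[ℝ] EuclideanSpace ℝ (Fin n)))
    (hG : ReflectionGroups.IsReflectionGroup G) (hess : ReflectionGroups.IsEssential G)
    (π : Fin n → MvPolynomial (Fin n) ℝ) (hπ : ReflectionGroups.IsBasicInvariants G π)
    (f : Fin m → MvPolynomial (Fin n) ℝ)
    (hX : (ReflectionGroups.realVariety f).Nonempty)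
    (j : Fin n) (hf : ∀ k, f k ∈ Algebra.adjoin ℝ (π '' {i | i ≠ j})) :
    (ReflectionGroups.realVariety f ∩ ReflectionGroups.stratum G (n - 1)).Nonempty := by
  open ReflectionGroups in
  by_contra hempty
  have hfin : Finite G := hG.finite
  obtain ⟨p, hp⟩ := hX
  obtain ⟨a, ha⟩ := exists_norm_sq_eq_sum hess hπ.homogeneous hπ.generate
  have hcont : Continuous fun t : ℝ => Function.update (polyMap π p) j t := by fun_prop
  let S : Set ℝ := {t | Function.update (polyMap π p) j t ∈ Set.range (polyMap π)}
  have hclosed : IsClosed S := (isClosed_range_polyMap ha).preimage hcont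
  have hopen : IsOpen S := by
    rw [isOpen_iff_mem_nhds]
    rintro t ⟨x, hx⟩
    have hxX : x ∈ realVariety f := fun k => by
      rw [← hp k]
      refine evalAt_eq_of_mem_adjoin ?_ (hf k)
      rintro _ ⟨i, hi, rfl⟩
      have h := congrFun hx i
      rwa [Function.update_of_ne hi] at h
    have hxs : x ∉ stratum G (n - 1) := fun h => hempty ⟨x, hxX, h⟩
    have hmap := map_nhds_polyMap (p := x) hπ.generate fun g hg hgx =>
      eq_one_of_apply_eq_self hG.generated.ge (inner_ne_zero_of_notMem_stratum hxs) hg hgx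
    have hrange : Set.range (polyMap π) ∈ nhds (polyMap π x) := by
      rw [← hmap]
      exact Filter.range_mem_map
    rw [hx] at hrange
    exact hcont.continuousAt.preimage_mem_nhds hrange
  have huniv : S = Set.univ :=
    IsClopen.eq_univ ⟨hclosed, hopen⟩ ⟨polyMap π p j, p, by rw [Function.update_eq_self]⟩
  obtain ⟨t, ht⟩ := exists_update_notMem_range_polyMap ha (polyMap π p) j
  exact ht (huniv ▸ Set.mem_univ t : t ∈ S)
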